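/- Let $R$ be a (unital, associative) ring. A pp-formula over $R$ is a first-order formula in the language $\{0,+,-\}\cup\{\text{multiplication by } r \mid r\in R\}$ of $R$-modules that consists of a finite string of existential quantifiers followed by a finite conjunction of atomic formulas. For a pp-formula $\psi$ with one free variable and an $R$-module $M$ put $\psi(M)=\{m\in M \mid M\models\psi(m)\}$. A sequence $\langle\psi_n\mid n<\omega\rangle$ of such formulas is called descending if $\psi_{n+1}(M)\subseteq\psi_n(M)$ for all $R$-modules $M$ and all $n<\omega$. A cardinal is called $\omega$-measurable if it is greater than or equal to some (uncountable) measurable cardinal. Let $\langle U_i\mid i\in I\rangle$ and $\langle V_j\mid j\in J\rangle$ be two families of $R$-modules with $J$ infinite, and assume that $\kappa=\sup_{i\in I}|U_i|$ is not $\omega$-measurable and that $|J|>\kappa$. Let $f:\prod_{i\in I}U_i\to\bigoplus_{j\in J}V_j$ be an epimorphism of $R$-modules, and let $\langle\psi_n\mid n<\omega\rangle$ be a descending sequence of pp-formulas with one free variable such that, for infinitely many $n<\omega$, the restriction of $f$ to $\psi_n\bigl(\prod_{i\in I}U_i\bigr)$ is onto $\psi_n\bigl(\bigoplus_{j\in J}V_j\bigr)$.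 Then there exists an infinite subset $L\subseteq J$ such that for every $j\in L$ the chain $\psi_0(V_j)\supseteq\psi_1(V_j)\supseteq\psi_2(V_j)\supseteq\cdots$ eventually stabilizes. -/

import Mathlib

open Cardinal FirstOrder
open scoped DirectSum

universe u v w

namespace PPModule

/-! ### Large cardinals -/

/-- A cardinal `κ` is measurable if it is uncountable and there is a nonprincipal
`κ`-complete ultrafilter on (a set of cardinality) `κ`; `κ`-complete means closed under
intersections of fewer than `κ` members. -/
def IsMeasurableCardinal (κ : Cardinal.{u}) : Prop :=
  ℵ₀ < κ ∧ ∃ D : Ultrafilter κ.out,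
    CardinalInterFilter (D : Filter κ.out) κ ∧ ∀ a : κ.out, D ≠ pure a

/-- A cardinal is `ω`-measurable if it is greater than or equal to the first measurable
cardinal, that is, to some measurable cardinal. -/
def IsOmegaMeasurable (κ : Cardinal.{u}) : Prop :=
  ∃ μ : Cardinal.{u}, IsMeasurableCardinal μ ∧ μ ≤ κ

/-! ### The first-order language of modules -/

/-- Function symbols of the language of `R`-modules: those of abelian groups, `0`, `-`, `+`,
together with a unary symbol for every `r : R`. -/
inductive ModuleFunc (R : Type u) : ℕ → Type u
  | zero : ModuleFunc R 0
  | neg : ModuleFunc R 1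
  | smul (r : R) : ModuleFunc R 1
  | add : ModuleFunc R 2

/-- The first-order language of `R`-modules; equality is the only relation. -/
def moduleLanguage (R : Type u) : FirstOrder.Language.{u, 0} where
  Functions := ModuleFunc R
  Relations := fun _ => Empty

/-- Every `R`-module is a structure for the language of `R`-modules. (Right modules over a ring
are the same as left modules over the opposite ring.) -/
instance moduleStructure (R : Type u) (M : Type v) [Ring R] [AddCommGroup M] [Module R M] :
    (moduleLanguage R).Structure M where
  funMap := fun {_} g x =>
    match g, x with
    | ModuleFunc.zero, _ => 0
    | ModuleFunc.neg, x => - x 0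
    | ModuleFunc.smul r, x => r • x 0
    | ModuleFunc.add, x => x 0 + x 1
  RelMap := fun {_} r _ => r.elim

/-! ### Positive-primitive formulas -/

/-- Finite conjunctions of (positive) atomic formulas. -/
inductive IsAtomicConj {L : FirstOrder.Language.{u, v}} {α : Type w} {n : ℕ} : L.BoundedFormula α n → Prop
  | of_isAtomic {φ : L.BoundedFormula α n} (h : φ.IsAtomic) : IsAtomicConj φ
  | inf {φ ψ : L.BoundedFormula α n} (hφ : IsAtomicConj φ) (hψ : IsAtomicConj ψ) :
      IsAtomicConj (φ ⊓ ψ)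

/-- Positive-primitive formulas: a finite string of existential quantifiers in front of a finite
conjunction of atomic formulas. -/
inductive IsPP {L : FirstOrder.Language.{u, v}} {α : Type w} : {n : ℕ} → L.BoundedFormula α n → Prop
  | of_isAtomicConj {n : ℕ} {φ : L.BoundedFormula α n} (h : IsAtomicConj φ) : IsPP φ
  | ex {n : ℕ} {φ : L.BoundedFormula α (n + 1)} (h : IsPP φ) : IsPP φ.ex

/-- `solutions M ψ` is `ψ(M) = {m ∈ M | M ⊨ ψ(m)}` for a formula `ψ` with one free variable. -/
def solutions {R : Type u} [Ring R] (M : Type v) [AddCommGroup M] [Module R M]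
    (ψ : (moduleLanguage R).Formula (Fin 1)) : Set M :=
  {m | ψ.Realize fun _ => m}

/-- The order on formulas with one free variable: `φ ≤ ψ` if and only if `φ → ψ` holds in all
modules (of the universe under consideration). -/
def FormulaLE {R : Type u} [Ring R] (φ ψ : (moduleLanguage R).Formula (Fin 1)) : Prop :=
  ∀ (M : Type v) [AddCommGroup M] [Module R M], solutions M φ ⊆ solutions M ψ

end PPModule

/-! Call a set of indices in `I` negligible if, for some `n`, elements of `∏ ψ_n(U_i)` supported
there map into `⋂ k, ψ_k(V_j)` for all `j` outside one finite set. A gliding-hump argument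
(`exists_isNegligible`) makes these sets a σ-ideal with no infinite disjoint family of
non-negligible sets, so finitely many countably complete ultrafilters detect every non-negligible
set (`exists_finite_ultrafilters`).

If only finitely many chains stabilize, then for almost every `j` some `h_j` in `ψ_n(V_j)` leaves
the chain later; lift it to `x_j` in `∏ ψ_n(U_i)`. As `κ` is not `ω`-measurable, `x_j`, coded in
`κ`, is constant on a member of each ultrafilter. If `x_j` and `x_j'` have the same constants, their
difference has negligible support, which keeps `h_j` in the whole chain, a contradiction. Hence `#J`
is at most a finite power of `κ`, contrary to `κ < #J`. -/

namespace PPModule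

/-! ### Countably complete ultrafilters -/

section Ultrafilters

open Filter

/-- A countably complete ultrafilter on a countable type is principal. -/
theorem eq_pure_of_countable {α : Type v} [Countable α] (D : Ultrafilter α)
    [CountableInterFilter (D : Filter α)] : ∃ a, D = pure a := by
  by_contra! h
  have h1 : ∀ a, ({a}ᶜ : Set α) ∈ (D : Filter α) := fun a => by
    rw [Ultrafilter.mem_coe, Ultrafilter.compl_mem_iff_notMem]
    intro ha
    obtain ⟨x, rfl, hx⟩ := Ultrafilter.eq_pure_of_finite_mem (Set.finite_singleton a) ha
    exact h x hx
  have h2 : (⋂ a : α, ({a}ᶜ : Set α)) ∈ (D : Filter α) := countable_iInter_mem.2 h1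
  have h3 : (⋂ a : α, ({a}ᶜ : Set α)) = ∅ := by
    ext x
    simp
  rw [h3] at h2
  exact D.neBot.ne (empty_mem_iff_bot.1 h2)

theorem countableInterFilter_map {α β : Type v} (D : Ultrafilter α)
    [CountableInterFilter (D : Filter α)] (g : α → β) :
    CountableInterFilter (D.map g : Filter β) := by
  rw [Ultrafilter.coe_map]
  infer_instance

theorem exists_fiber_mem_of_map_eq_pure {α β : Type v} {D : Ultrafilter α} {g : α → β}
    (h : ∃ b, D.map g = pure b) : ∃ b, g ⁻¹' {b} ∈ D := by
  obtain ⟨b, hb⟩ := h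
  refine ⟨b, ?_⟩
  rw [← Ultrafilter.mem_map, hb]
  exact Set.mem_singleton b

/-- `κ` carries a nonprincipal countably complete ultrafilter. -/
def HasCountablyCompleteUltrafilter (κ : Cardinal.{v}) : Prop :=
  ∃ (α : Type v) (D : Ultrafilter α), #α = κ ∧ CountableInterFilter (D : Filter α) ∧
    ∀ a, D ≠ pure a

/-- The least cardinal with a nonprincipal countably complete ultrafilter is measurable. -/
theorem HasCountablyCompleteUltrafilter.isOmegaMeasurable {κ : Cardinal.{v}}
    (h : HasCountablyCompleteUltrafilter κ) : IsOmegaMeasurable κ := by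
  classical
  obtain ⟨μ, hμ, hmin⟩ := WellFounded.has_min Cardinal.lt_wf
    {c : Cardinal.{v} | HasCountablyCompleteUltrafilter c} ⟨κ, h⟩
  have hle : μ ≤ κ := not_lt.1 (hmin κ h)
  refine ⟨μ, ?_, hle⟩
  obtain ⟨α, D₀, hα, hD₀, hne₀⟩ := hμ
  obtain ⟨e⟩ : Nonempty (α ≃ μ.out) := Cardinal.eq.1 (by rw [hα, Cardinal.mk_out])
  let D : Ultrafilter μ.out := D₀.map e
  have hD : CountableInterFilter (D : Filter μ.out) := countableInterFilter_map D₀ e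
  have hne : ∀ a, D ≠ pure a := by
    intro a ha
    refine hne₀ (e.symm a) ?_
    have : D.map e.symm = pure (e.symm a) := by
      rw [ha, Ultrafilter.map_pure]
    rw [← this, Ultrafilter.map_map]
    simp
  have hunc : ℵ₀ < μ := by
    by_contra hcon
    have : Countable μ.out := by
      rw [← Cardinal.mk_le_aleph0_iff, Cardinal.mk_out]
      exact not_lt.1 hcon
    obtain ⟨a, ha⟩ := eq_pure_of_countable D
    exact hne a ha
  refine ⟨hunc, D, ⟨fun S hS hSD => ?_⟩, hne⟩
  -- Label each point by a member of `S` missing it, or by `none`. By minimality of `μ` the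
  -- pushed-forward ultrafilter is principal; its fiber cannot be that of some `s`, being disjoint
  -- from `s ∈ D`.
  have hex : ∀ a : μ.out, ∃ z : Option S, (∀ s, z = some s → a ∉ s.1) ∧
      (z = none → a ∈ ⋂₀ S) := by
    intro a
    by_cases ha : a ∈ ⋂₀ S
    · exact ⟨none, by simp, fun _ => ha⟩
    · simp only [Set.mem_sInter, not_forall] at ha
      obtain ⟨s, hs, has⟩ := ha
      refine ⟨some ⟨s, hs⟩, ?_, by simp⟩
      rintro t ht
      cases ht
      exact has
  choose g hg1 hg2 using hex
  have hcard : #(Option S) < μ := by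
    rw [Cardinal.mk_option]
    exact Cardinal.add_lt_of_lt hunc.le hS (Cardinal.one_lt_aleph0.trans hunc)
  have hpr : ∃ z, D.map g = pure z := by
    by_contra! hcon
    exact hmin _ ⟨Option S, D.map g, rfl, countableInterFilter_map D g, hcon⟩ hcard
  obtain ⟨z, hz⟩ := exists_fiber_mem_of_map_eq_pure hpr
  cases z with
  | none => exact mem_of_superset hz fun a ha => hg2 a ha
  | some s =>
    exfalso
    have h1 : (s : Set μ.out)ᶜ ∈ D := mem_of_superset hz fun a ha => hg1 a s ha
    exact (Ultrafilter.compl_mem_iff_notMem.1 h1) (hSD s s.2)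

/-- A countably complete ultrafilter picks a fiber of every map to a set whose cardinality is not
`ω`-measurable. -/
theorem exists_fiber_mem {I S : Type v} (hS : ¬ IsOmegaMeasurable #S) (D : Ultrafilter I)
    [CountableInterFilter (D : Filter I)] (g : I → S) : ∃ s, g ⁻¹' {s} ∈ D := by
  apply exists_fiber_mem_of_map_eq_pure
  by_contra! hcon
  exact hS (HasCountablyCompleteUltrafilter.isOmegaMeasurable
    ⟨S, D.map g, rfl, countableInterFilter_map D g, hcon⟩)

end Ultrafilters

/-! ### `σ`-ideals without infinite disjoint families of positive sets -/

section Ideals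

open Filter

variable {I : Type v}

/-- If positive sets cannot be split infinitely often, then finitely many countably complete
ultrafilters detect all positive sets. -/
theorem exists_finite_ultrafilters (P : Set I → Prop) (hempty : P ∅)
    (hmono : ∀ A B, A ⊆ B → P B → P A) (hunion : ∀ A : ℕ → Set I, (∀ k, P (A k)) → P (⋃ k, A k))
    (hsplit : ∀ B : ℕ → Set I, Antitone B → ∃ m, P (B m \ B (m + 1))) :
    ∃ T : Set (Ultrafilter I), T.Finite ∧ (∀ D ∈ T, CountableInterFilter (D : Filter I)) ∧
      ∀ A, ¬ P A → ∃ D ∈ T, A ∈ D := by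
  classical
  have hunion₂ : ∀ A B, P A → P B → P (A ∪ B) := by
    intro A B hA hB
    refine hmono _ (⋃ k : ℕ, if k = 0 then A else B) ?_ (hunion _ fun k => ?_)
    · rintro x (hx | hx)
      · exact Set.mem_iUnion.2 ⟨0, by simpa using hx⟩
      · exact Set.mem_iUnion.2 ⟨1, by simpa using hx⟩
    · split_ifs <;> assumption
  let Q : Set I → Prop := fun B => ∃ T : Set (Ultrafilter I), T.Finite ∧
    (∀ D ∈ T, CountableInterFilter (D : Filter I)) ∧ ∀ A ⊆ B, ¬ P A → ∃ D ∈ T, A ∈ D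
  have hQnull : ∀ B, P B → Q B := fun B hB =>
    ⟨∅, Set.finite_empty, by simp, fun A hAB hA => absurd (hmono A B hAB hB) hA⟩
  have hQunion : ∀ B C, Q B → Q C → Q (B ∪ C) := by
    rintro B C ⟨T, hT, hTc, hTB⟩ ⟨T', hT', hTc', hTC⟩
    refine ⟨T ∪ T', hT.union hT', fun D hD => hD.elim (hTc D) (hTc' D), fun A hA hPA => ?_⟩
    by_cases h1 : P (A ∩ B)
    · by_cases h2 : P (A ∩ C)
      · refine absurd (hmono _ _ ?_ (hunion₂ _ _ h1 h2)) hPA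
        rw [← Set.inter_union_distrib_left]
        exact Set.subset_inter le_rfl hA
      · obtain ⟨D, hD, hAD⟩ := hTC _ Set.inter_subset_right h2
        exact ⟨D, Or.inr hD, mem_of_superset hAD Set.inter_subset_left⟩
    · obtain ⟨D, hD, hAD⟩ := hTB _ Set.inter_subset_right h1
      exact ⟨D, Or.inl hD, mem_of_superset hAD Set.inter_subset_left⟩
  have hQatom : ∀ B, ¬ P B → (∀ C ⊆ B, P C ∨ P (B \ C)) → Q B := by
    intro B hB hatom
    let D₀ : Filter I :=
      { sets := {A | P (B \ A)}
        univ_sets := by simpa using hempty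
        sets_of_superset := fun {X Y} hX hXY => hmono _ _ (Set.sdiff_subset_sdiff_right hXY) hX
        inter_sets := fun {X Y} hX hY => by
          change P (B \ (X ∩ Y))
          rw [Set.sdiff_inter]
          exact hunion₂ _ _ hX hY }
    have hmem : ∀ A, A ∈ D₀ ↔ P (B \ A) := fun A => Iff.rfl
    let D : Ultrafilter I := Ultrafilter.ofComplNotMemIff D₀ fun A => by
      rw [hmem, hmem]
      constructor
      · intro h
        have := hatom (B \ A) Set.sdiff_subset
        refine this.resolve_right fun h' => h ?_
        refine hmono _ _ ?_ h'
        rintro x ⟨hx, hx'⟩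
        exact ⟨hx, fun h'' => h''.2 (not_not.1 hx')⟩
      · intro h h'
        refine hB (hmono _ _ ?_ (hunion₂ _ _ h h'))
        intro x hx
        by_cases hxA : x ∈ A
        · exact Or.inr ⟨hx, fun h'' => h'' hxA⟩
        · exact Or.inl ⟨hx, hxA⟩
    have hmemD : ∀ A, A ∈ (D : Filter I) ↔ P (B \ A) := fun A => Iff.rfl
    refine ⟨{D}, Set.finite_singleton D, ?_, ?_⟩
    · rintro _ rfl
      refine ⟨fun S hS hSD => ?_⟩
      rcases S.eq_empty_or_nonempty with rfl | hne
      · simp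
      · obtain ⟨A, rfl⟩ := hS.exists_eq_range hne
        rw [hmemD]
        refine hmono _ _ ?_ (hunion (fun k => B \ A k) fun k =>
          (hmemD _).1 (hSD _ (Set.mem_range_self k)))
        rintro x ⟨hx, hx'⟩
        simp only [Set.sInter_range, Set.mem_iInter, not_forall] at hx'
        obtain ⟨k, hk⟩ := hx'
        exact Set.mem_iUnion.2 ⟨k, hx, hk⟩
    · intro A hAB hA
      refine ⟨D, rfl, ?_⟩
      rw [← Ultrafilter.mem_coe, hmemD]
      exact (hatom A hAB).resolve_left hA
  suffices h : Q Set.univ by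
    obtain ⟨T, hT, hTc, hTA⟩ := h
    exact ⟨T, hT, hTc, fun A => hTA A (Set.subset_univ A)⟩
  by_contra hcon
  -- A set failing `Q` is positive and no atom, so it splits into two positive pieces, one of which
  -- again fails `Q`. Iterating contradicts `hsplit`.
  have hstep : ∀ B : {B : Set I // ¬ Q B}, ∃ C : {B : Set I // ¬ Q B},
      C.1 ⊆ B.1 ∧ ¬ P (B.1 \ C.1) := by
    rintro ⟨B, hB⟩
    have h1 : ¬ P B := fun h => hB (hQnull B h)
    have h2 : ∃ C ⊆ B, ¬ P C ∧ ¬ P (B \ C) := by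
      by_contra! h
      exact hB (hQatom B h1 fun C hC => or_iff_not_imp_left.2 (h C hC))
    obtain ⟨C, hCB, hC, hC'⟩ := h2
    by_cases hQC : Q C
    · refine ⟨⟨B \ C, fun h => hB ?_⟩, Set.sdiff_subset, ?_⟩
      · have := hQunion _ _ hQC h
        rwa [Set.union_sdiff_cancel hCB] at this
      · simpa [Set.inter_eq_self_of_subset_right hCB] using hC
    · exact ⟨⟨C, hQC⟩, hCB, hC'⟩
  choose step hstep1 hstep2 using hstep
  let B : ℕ → {B : Set I // ¬ Q B} := fun k => Nat.rec ⟨Set.univ, hcon⟩ (fun _ => step) k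
  obtain ⟨m, hm⟩ := hsplit (fun k => (B k).1) (antitone_nat_of_succ_le fun k => hstep1 (B k))
  exact hstep2 (B m) hm

end Ideals

/-! ### Homomorphisms from products to direct sums -/

section Products

variable {I J : Type v} {U : I → Type v} {V : J → Type v} [∀ i, AddCommGroup (U i)]
  [∀ j, AddCommGroup (V j)]

/-- A set `A` of indices is negligible if, for some `n`, all elements of `∏ G n i` supported on
`A` are mapped into `⋂ k, H k j` in all but finitely many coordinates `j`, which do not depend on
the element. -/
def IsNegligible (G : ℕ → ∀ i, AddSubgroup (U i)) (H : ℕ → ∀ j, AddSubgroup (V j))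
    (f : (∀ i, U i) →+ ∀ j, V j) (A : Set I) : Prop :=
  ∃ (n : ℕ) (F : Finset J), ∀ x : ∀ i, U i, (∀ i, x i ∈ G n i) → (∀ i, i ∉ A → x i = 0) →
    ∀ j, j ∉ F → ∀ k, f x j ∈ H k j

variable {G : ℕ → ∀ i, AddSubgroup (U i)} {H : ℕ → ∀ j, AddSubgroup (V j)}
  {f : (∀ i, U i) →+ ∀ j, V j}

theorem IsNegligible.mono {A B : Set I} (hAB : A ⊆ B) (hB : IsNegligible G H f B) :
    IsNegligible G H f A := by
  obtain ⟨n, F, h⟩ := hB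
  exact ⟨n, F, fun x hx hxA => h x hx fun i hi => hxA i fun h' => hi (hAB h')⟩

theorem isNegligible_empty : IsNegligible G H f ∅ := by
  refine ⟨0, ∅, fun x _ hx j _ k => ?_⟩
  have : x = 0 := funext fun i => hx i (Set.notMem_empty i)
  rw [this, map_zero]
  exact (H k j).zero_mem

theorem IsNegligible.union (hG : Antitone G) {A B : Set I} (hA : IsNegligible G H f A)
    (hB : IsNegligible G H f B) : IsNegligible G H f (A ∪ B) := by
  classical
  obtain ⟨n, F, h⟩ := hA
  obtain ⟨n', F', h'⟩ := hB
  refine ⟨max n n', F ∪ F', fun x hx hxAB j hj k => ?_⟩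
  simp only [Finset.mem_union, not_or] at hj
  have hsplit : x = (fun i => if i ∈ A then x i else 0) + fun i => if i ∈ A then 0 else x i := by
    funext i
    by_cases hi : i ∈ A <;> simp [hi]
  rw [hsplit, map_add]
  refine (H k j).add_mem (h _ (fun i => ?_) (fun i hi => by simp [hi]) j hj.1 k)
    (h' _ (fun i => ?_) (fun i hi => ?_) j hj.2 k)
  · split_ifs
    · exact hG (le_max_left n n') i (hx i)
    · exact (G n i).zero_mem
  · split_ifs
    · exact (G n' i).zero_mem
    · exact hG (le_max_right n n') i (hx i)
  · split_ifs with hiA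
    · rfl
    · exact hxAB i fun h => h.elim hiA hi

/-- Chase's lemma: if the `B k` decrease to the empty set, some `B k` is negligible. -/
theorem exists_isNegligible (hG : Antitone G) (hH : Antitone H)
    (hfin : ∀ x, {j | f x j ≠ 0}.Finite)
    (hmap : ∀ n x, (∀ i, x i ∈ G n i) → ∀ j, f x j ∈ H n j)
    {B : ℕ → Set I} (hB : Antitone B) (hBe : ∀ i, ∃ m, i ∉ B m) :
    ∃ m, IsNegligible G H f (B m) := by
  classical
  by_contra! hcon
  have hbad : ∀ (m n : ℕ) (F : Finset J), ∃ (x : ∀ i, U i) (j : J) (k : ℕ),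
      (∀ i, x i ∈ G n i) ∧ (∀ i, i ∉ B m → x i = 0) ∧ j ∉ F ∧ f x j ∉ H k j := by
    intro m n F
    by_contra! h
    exact hcon m ⟨n, F, fun x hx hxB j hj k => h x j k hx hxB hj⟩
  choose X jj kk hXG hXB hjF hjH using hbad
  -- The level rises until `H` witnesses the current failure; the finite set absorbs the chosen
  -- coordinate and the support of the current image.
  let next : ℕ → ℕ × Finset J → ℕ × Finset J := fun m p =>
    (max p.1 (kk m p.1 p.2),
      insert (jj m p.1 p.2) (p.2 ∪ (hfin (X m p.1 p.2)).toFinset))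
  let st : ℕ → ℕ × Finset J := fun k => Nat.rec (0, ∅) (fun m p => next m p) k
  have hst : ∀ k, st (k + 1) = next k (st k) := fun k => rfl
  let x : ℕ → ∀ i, U i := fun k => X k (st k).1 (st k).2
  let j : ℕ → J := fun k => jj k (st k).1 (st k).2
  have hn : Monotone fun k => (st k).1 :=
    monotone_nat_of_le_succ fun k => by rw [hst]; exact le_max_left _ _
  have hF : Monotone fun k => (st k).2 := monotone_nat_of_le_succ fun k => by
    rw [hst]
    exact Finset.subset_union_left.trans (Finset.subset_insert _ _)
  have hjmem : ∀ k, j k ∈ (st (k + 1)).2 := fun k => by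
    rw [hst]
    exact Finset.mem_insert_self _ _
  have hjnot : ∀ k, j k ∉ (st k).2 := fun k => hjF k _ _
  have hjlt : ∀ k l, k < l → j k ≠ j l := fun k l hkl h =>
    hjnot l (h ▸ hF (Nat.succ_le_of_lt hkl) (hjmem k))
  have hjinj : Function.Injective j := by
    intro k l h
    rcases lt_trichotomy k l with hkl | hkl | hkl
    · exact absurd h (hjlt k l hkl)
    · exact hkl
    · exact absurd h.symm (hjlt l k hkl)
  have hzero : ∀ k l, l < k → f (x l) (j k) = 0 := by
    intro k l hlk
    by_contra h
    refine hjnot k (hF (Nat.succ_le_of_lt hlk) ?_)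
    change j k ∈ (st (l + 1)).2
    rw [hst]
    refine Finset.mem_insert_of_mem (Finset.mem_union_right _ ?_)
    rw [Set.Finite.mem_toFinset]
    exact h
  have hnotH : ∀ k, f (x k) (j k) ∉ H (st (k + 1)).1 (j k) := fun k h =>
    hjH k (st k).1 (st k).2 (hH (by rw [hst]; exact le_max_right _ _) (j k) h)
  have hxG : ∀ k i, x k i ∈ G (st k).1 i := fun k i => hXG k _ _ i
  have hxB : ∀ k i, i ∉ B k → x k i = 0 := fun k i => hXB k _ _ i
  choose m hm using hBe
  have hxm : ∀ k i, m i ≤ k → x k i = 0 := fun k i hk => hxB k i fun h => hm i (hB hk h)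
  -- The infinite sum of the `x l`, finite at each `i`. At `j k` earlier terms contribute nothing
  -- and later ones stay in a subgroup missing `f (x k) (j k)`.
  let s : ∀ i, U i := fun i => ∑ l ∈ Finset.range (m i), x l i
  have htail : ∀ k i, (s - ∑ l ∈ Finset.range k, x l) i ∈ G (st k).1 i := by
    intro k i
    rw [Pi.sub_apply, Finset.sum_apply]
    rcases le_total k (m i) with hk | hk
    · rw [← Finset.sum_Ico_eq_sub _ hk]
      exact AddSubgroup.sum_mem _ fun l hl => hG (hn (Finset.mem_Ico.1 hl).1) i (hxG l i)
    · have : ∑ l ∈ Finset.range k, x l i = s i :=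
        (Finset.sum_subset (Finset.range_mono hk) fun l _ hl =>
          hxm l i (by simpa using hl)).symm
      rw [this, sub_self]
      exact AddSubgroup.zero_mem _
  have hne : ∀ k, f s (j k) ≠ 0 := by
    intro k h0
    have h1 := hmap _ _ (htail (k + 1)) (j k)
    rw [map_sub, map_sum, Pi.sub_apply, h0, Finset.sum_apply, Finset.sum_range_succ,
      Finset.sum_eq_zero fun l hl => hzero k l (Finset.mem_range.1 hl), zero_add, zero_sub,
      AddSubgroup.neg_mem_iff] at h1
    exact hnotH k h1
  exact Set.infinite_of_injective_forall_mem hjinj hne (hfin s)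

/-- The union minus its partial unions decreases to the empty set, so some remainder is negligible.
-/
theorem isNegligible_iUnion (hG : Antitone G) (hH : Antitone H)
    (hfin : ∀ x, {j | f x j ≠ 0}.Finite)
    (hmap : ∀ n x, (∀ i, x i ∈ G n i) → ∀ j, f x j ∈ H n j)
    (A : ℕ → Set I) (hA : ∀ k, IsNegligible G H f (A k)) : IsNegligible G H f (⋃ k, A k) := by
  have hpart : ∀ m, IsNegligible G H f (⋃ k < m, A k) := by
    intro m
    induction m with
    | zero => simpa using isNegligible_empty
    | succ m ih =>
      rw [Set.biUnion_lt_succ]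
      exact ih.union hG (hA m)
  obtain ⟨m, hm⟩ := exists_isNegligible hG hH hfin hmap
    (B := fun m => (⋃ k, A k) \ ⋃ k < m, A k)
    (fun m m' h => Set.sdiff_subset_sdiff_right
      (Set.biUnion_subset_biUnion_left fun k (hk : k < m) => hk.trans_le h))
    (fun i => by
      by_cases hi : i ∈ ⋃ k, A k
      · obtain ⟨k, hk⟩ := Set.mem_iUnion.1 hi
        exact ⟨k + 1, fun h => h.2 (Set.mem_biUnion (Nat.lt_succ_self k) hk)⟩
      · exact ⟨0, fun h => hi h.1⟩)
  refine (hm.union hG (hpart m)).mono ?_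
  rw [Set.sdiff_union_self]
  exact Set.subset_union_left

/-- The bounds witnessing negligibility can be chosen uniformly for all negligible sets. -/
theorem exists_uniform_bound (hG : Antitone G) (hH : Antitone H)
    (hfin : ∀ x, {j | f x j ≠ 0}.Finite)
    (hmap : ∀ n x, (∀ i, x i ∈ G n i) → ∀ j, f x j ∈ H n j) :
    ∃ (n : ℕ) (F : Finset J), ∀ x : ∀ i, U i, (∀ i, x i ∈ G n i) →
      IsNegligible G H f {i | x i ≠ 0} → ∀ j, j ∉ F → ∀ k, f x j ∈ H k j := by
  classical
  by_contra! hcon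
  choose X hXG hXN jj hjF kk hjH using hcon
  -- Counterexamples at every level, with distinct bad coordinates. The union of their supports is
  -- negligible, and its single bound fails from level `n` on.
  let F : ℕ → Finset J := fun k => Nat.rec ∅ (fun m F => insert (jj m F) F) k
  have hF : ∀ k, F (k + 1) = insert (jj k (F k)) (F k) := fun k => rfl
  have hFmono : Monotone F := monotone_nat_of_le_succ fun k => by
    rw [hF]
    exact Finset.subset_insert _ _
  obtain ⟨n, F', h⟩ := isNegligible_iUnion hG hH hfin hmap
    (fun k => {i | X k (F k) i ≠ 0}) fun k => hXN k (F k)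
  have hjlt : ∀ k l, k < l → jj k (F k) ≠ jj l (F l) := fun k l hkl h =>
    hjF l (F l) (h ▸ hFmono (Nat.succ_le_of_lt hkl) (by
      change _ ∈ F (k + 1)
      rw [hF]
      exact Finset.mem_insert_self _ _))
  have hinj : Function.Injective fun k => jj (n + k) (F (n + k)) := by
    intro k l hkl
    rcases lt_trichotomy k l with hlt | hlt | hlt
    · exact absurd hkl (hjlt _ _ (by omega))
    · exact hlt
    · exact absurd hkl.symm (hjlt _ _ (by omega))
  refine Set.infinite_of_injective_forall_mem (s := (F' : Set J)) hinj (fun k => ?_)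
    F'.finite_toSet
  by_contra hk
  refine hjH (n + k) (F (n + k)) (h _ (fun i => hG (Nat.le_add_right n k) i (hXG _ _ i))
    (fun i hi => ?_) _ hk _)
  by_contra hi'
  exact hi (Set.mem_iUnion.2 ⟨n + k, hi'⟩)

theorem infinite_setOf_stabilizes [Infinite J] (hG : Antitone G) (hH : Antitone H)
    (hfin : ∀ x, {j | f x j ≠ 0}.Finite)
    (hmap : ∀ n x, (∀ i, x i ∈ G n i) → ∀ j, f x j ∈ H n j)
    {κ : Cardinal.{v}} (hκ : ¬ IsOmegaMeasurable κ) (hU : ∀ i, #(U i) ≤ κ) (hJ : κ < #J)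
    (honto : {n | ∀ j, ∀ h ∈ H n j, ∃ x, (∀ i, x i ∈ G n i) ∧ f x j = h ∧
      ∀ j', j' ≠ j → f x j' = 0}.Infinite) :
    {j | ∃ N, ∀ n, N ≤ n → H n j = H N j}.Infinite := by
  classical
  intro hL
  obtain ⟨T, hT, hTc, hTP⟩ := exists_finite_ultrafilters (IsNegligible G H f) isNegligible_empty
    (fun A B hAB hB => hB.mono hAB) (isNegligible_iUnion hG hH hfin hmap) (by
      intro B hB
      -- Removing the intersection gives a sequence decreasing to the empty set.
      obtain ⟨m, hm⟩ := exists_isNegligible hG hH hfin hmap (B := fun m => B m \ ⋂ k, B k)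
        (fun m m' h => Set.sdiff_subset_sdiff_left (hB h)) (fun i => by
          by_cases hi : i ∈ ⋂ k, B k
          · exact ⟨0, fun h => h.2 hi⟩
          · obtain ⟨k, hk⟩ := not_forall.1 (mt Set.mem_iInter.2 hi)
            exact ⟨k, fun h => hk h.1⟩)
      exact ⟨m, hm.mono (Set.sdiff_subset_sdiff_right (Set.iInter_subset _ _))⟩)
  obtain ⟨n₀, F, hF⟩ := exists_uniform_bound hG hH hfin hmap
  obtain ⟨n, hn, hn₀⟩ := honto.exists_gt n₀
  have hlift : ∀ j : {j // j ∉ F ∪ hL.toFinset}, ∃ x : ∀ i, U i, (∀ i, x i ∈ G n i) ∧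
      (∃ k, f x j ∉ H k j) ∧ ∀ j', j' ≠ j.1 → f x j' = 0 := by
    rintro ⟨j, hj⟩
    simp only [Finset.mem_union, Set.Finite.mem_toFinset, Set.mem_ofPred_eq, not_or,
      not_exists] at hj
    have hex : ∃ h ∈ H n j, ∃ k, h ∉ H k j := by
      by_contra! hcon
      exact hj.2 n fun l hl => le_antisymm (hH hl j) fun h hh => hcon h hh l
    obtain ⟨h, hh, k, hk⟩ := hex
    obtain ⟨x, hx, hxj, hx'⟩ := hn j h hh
    exact ⟨x, hx, ⟨k, hxj ▸ hk⟩, hx'⟩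
  choose x hxG hxk hx0 using hlift
  have hemb : ∀ i, Nonempty (U i ↪ κ.out) := fun i => by
    rw [← Cardinal.le_def, Cardinal.mk_out]
    exact hU i
  let e : ∀ i, U i ↪ κ.out := fun i => (hemb i).some
  have hfib : ∀ (D : T) (y : ∀ i, U i), ∃ s : κ.out, {i | e i (y i) = s} ∈ D.1 := fun D y => by
    have := hTc D.1 D.2
    exact exists_fiber_mem (by rwa [Cardinal.mk_out]) D.1 fun i => e i (y i)
  choose c hc using hfib
  have hinj : Function.Injective fun j => fun D : T => c D (x j) := by
    intro j j' hjj'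
    by_contra hne
    have hneg : IsNegligible G H f {i | (x j - x j') i ≠ 0} := by
      by_contra hcon
      obtain ⟨D, hD, hAD⟩ := hTP _ hcon
      have h1 := hc ⟨D, hD⟩ (x j)
      have h2 := hc ⟨D, hD⟩ (x j')
      obtain ⟨i, ⟨hi1, hi2⟩, hi⟩ := D.nonempty_of_mem
        (Filter.inter_mem (Filter.inter_mem h1 h2) hAD)
      refine hi (sub_eq_zero.2 ((e i).injective ?_))
      rw [Set.mem_ofPred_eq] at hi1 hi2
      rw [hi1, hi2]
      exact congrFun hjj' ⟨D, hD⟩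
    obtain ⟨k, hk⟩ := hxk j
    refine hk ?_
    have h3 := hF (x j - x j') (fun i => (G n₀ i).sub_mem (hG hn₀.le i (hxG j i)) (hG hn₀.le i (hxG j' i)))
      hneg j.1 (fun h => j.2 (Finset.mem_union_left _ h)) k
    rwa [map_sub, Pi.sub_apply, hx0 j' j fun h => hne (Subtype.ext h), sub_zero] at h3
  have hcard : #{j // j ∉ F ∪ hL.toFinset} = #J :=
    Cardinal.mk_compl_finset_of_infinite _
  have hle : #J ≤ #(T → κ.out) := hcard ▸ Cardinal.mk_le_of_injective hinj
  have hTfin : Finite T := hT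
  rcases lt_or_ge κ ℵ₀ with hfinκ | hinfκ
  · have : Finite κ.out := by
      rw [← Cardinal.lt_aleph0_iff_finite, Cardinal.mk_out]
      exact hfinκ
    exact (Cardinal.aleph0_le_mk J).not_gt (hle.trans_lt (Cardinal.lt_aleph0_of_finite _))
  · refine hJ.not_ge (hle.trans ?_)
    have := Fintype.ofFinite T
    rw [← Cardinal.power_def, Cardinal.mk_out, Cardinal.mk_fintype]
    exact Cardinal.power_nat_le hinfκ

end Products
end PPModule

namespace PPModule

/-! ### Positive-primitive formulas in modules -/

section Formulas

open FirstOrder.Language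

variable {R : Type u} [Ring R]

/-- Linear maps are homomorphisms for the language of modules. -/
def languageHom {M : Type v} {N : Type w} [AddCommGroup M] [AddCommGroup N] [Module R M]
    [Module R N] (g : M →ₗ[R] N) : M →[moduleLanguage R] N where
  toFun := g
  map_fun' := by
    rintro _ (_ | _ | r | _) x
    · exact map_zero g
    · exact map_neg g (x 0)
    · exact map_smul g r (x 0)
    · exact map_add g (x 0) (x 1)
  map_rel' := fun r _ _ => r.elim

theorem realize_term_map {M : Type v} {N : Type w} [AddCommGroup M] [AddCommGroup N] [Module R M]
    [Module R N] (g : M →ₗ[R] N) {α : Type*} (t : (moduleLanguage R).Term α) (v : α → M) :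
    t.realize (fun a => g (v a)) = g (t.realize v) :=
  HomClass.realize_term (languageHom g)

theorem elim_map {α β M N : Type*} (g : M → N) (v : α → M) (w : β → M) :
    Sum.elim (fun a => g (v a)) (fun b => g (w b)) = fun a => g (Sum.elim v w a) :=
  (Sum.comp_elim g v w).symm

theorem IsAtomicConj.realize_map {M : Type v} {N : Type w} [AddCommGroup M] [AddCommGroup N]
    [Module R M] [Module R N] (g : M →ₗ[R] N) {α : Type*} {n : ℕ}
    {φ : (moduleLanguage R).BoundedFormula α n} (hφ : IsAtomicConj φ) {v : α → M} {xs : Fin n → M}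
    (h : φ.Realize v xs) : φ.Realize (fun a => g (v a)) (fun a => g (xs a)) := by
  induction hφ with
  | of_isAtomic hφ =>
    cases hφ with
    | equal t₁ t₂ =>
      rw [BoundedFormula.realize_bdEqual] at h ⊢
      rw [elim_map, realize_term_map, realize_term_map, h]
    | rel r ts => exact r.elim
  | inf _ _ ih₁ ih₂ =>
    rw [BoundedFormula.realize_inf] at h ⊢
    exact ⟨ih₁ h.1, ih₂ h.2⟩

theorem IsPP.realize_map {M : Type v} {N : Type w} [AddCommGroup M] [AddCommGroup N]
    [Module R M] [Module R N] (g : M →ₗ[R] N) {α : Type*} {n : ℕ}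
    {φ : (moduleLanguage R).BoundedFormula α n} (hφ : IsPP φ) {v : α → M} {xs : Fin n → M}
    (h : φ.Realize v xs) : φ.Realize (fun a => g (v a)) (fun a => g (xs a)) := by
  induction hφ with
  | of_isAtomicConj hφ => exact hφ.realize_map g h
  | ex _ ih =>
    rw [BoundedFormula.realize_ex] at h ⊢
    obtain ⟨a, ha⟩ := h
    refine ⟨g a, ?_⟩
    have := ih ha
    rwa [show (fun b => g ((Fin.snoc xs a : Fin _ → M) b)) = Fin.snoc (fun b => g (xs b)) (g a) from
      Fin.comp_snoc g xs a] at this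

theorem IsAtomicConj.realize_pi {I : Type w} {M : I → Type v} [∀ i, AddCommGroup (M i)]
    [∀ i, Module R (M i)] {α : Type*} {n : ℕ} {φ : (moduleLanguage R).BoundedFormula α n}
    (hφ : IsAtomicConj φ) {v : α → ∀ i, M i} {xs : Fin n → ∀ i, M i}
    (h : ∀ i, φ.Realize (fun a => v a i) (fun a => xs a i)) : φ.Realize v xs := by
  induction hφ with
  | of_isAtomic hφ =>
    cases hφ with
    | equal t₁ t₂ =>
      rw [BoundedFormula.realize_bdEqual]
      funext i
      have hi := h i
      rw [BoundedFormula.realize_bdEqual] at hi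
      have he : Sum.elim (fun a => v a i) (fun a => xs a i) =
          fun a => LinearMap.proj (R := R) (φ := M) i (Sum.elim v xs a) :=
        elim_map (fun y : ∀ i, M i => y i) v xs
      rwa [he, realize_term_map, realize_term_map] at hi
    | rel r ts => exact r.elim
  | inf _ _ ih₁ ih₂ =>
    rw [BoundedFormula.realize_inf]
    exact ⟨ih₁ fun i => (BoundedFormula.realize_inf.1 (h i)).1,
      ih₂ fun i => (BoundedFormula.realize_inf.1 (h i)).2⟩

/-- Existential witnesses are chosen coordinatewise. -/
theorem IsPP.realize_pi {I : Type w} {M : I → Type v} [∀ i, AddCommGroup (M i)]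
    [∀ i, Module R (M i)] {α : Type*} {n : ℕ} {φ : (moduleLanguage R).BoundedFormula α n}
    (hφ : IsPP φ) {v : α → ∀ i, M i} {xs : Fin n → ∀ i, M i}
    (h : ∀ i, φ.Realize (fun a => v a i) (fun a => xs a i)) : φ.Realize v xs := by
  induction hφ with
  | of_isAtomicConj hφ => exact hφ.realize_pi h
  | ex _ ih =>
    simp only [BoundedFormula.realize_ex] at h ⊢
    choose a ha using h
    refine ⟨a, ih fun i => ?_⟩
    rw [show (fun b => (Fin.snoc xs a : Fin _ → ∀ i, M i) b i) =
      Fin.snoc (fun b => xs b i) (a i) from Fin.comp_snoc (fun y : ∀ i, M i => y i) xs a]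
    exact ha i

variable {φ : (moduleLanguage R).Formula (Fin 1)}

theorem IsPP.map_mem_solutions {M : Type v} {N : Type w} [AddCommGroup M] [AddCommGroup N]
    [Module R M] [Module R N] (hφ : IsPP φ) (g : M →ₗ[R] N) {x : M} (hx : x ∈ solutions M φ) :
    g x ∈ solutions N φ := by
  have := hφ.realize_map g (v := fun _ => x) (xs := default) hx
  rwa [Subsingleton.elim (fun a => g ((default : Fin 0 → M) a)) default] at this

theorem IsPP.mem_solutions_pi {I : Type w} {M : I → Type v} [∀ i, AddCommGroup (M i)]
    [∀ i, Module R (M i)] (hφ : IsPP φ) {x : ∀ i, M i} (hx : ∀ i, x i ∈ solutions (M i) φ) :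
    x ∈ solutions (∀ i, M i) φ := by
  refine hφ.realize_pi (v := fun _ => x) (xs := default) fun i => ?_
  rw [Subsingleton.elim (fun a : Fin 0 => (default : Fin 0 → ∀ i, M i) a i) default]
  exact hx i

/-- The solutions of a pp-formula in one variable form a subgroup. -/
def IsPP.subgroup (hφ : IsPP φ) (M : Type v) [AddCommGroup M] [Module R M] : AddSubgroup M where
  carrier := solutions M φ
  -- In the empty product every element is vacuously a solution.
  zero_mem' := hφ.map_mem_solutions (0 : (Empty → M) →ₗ[R] M)
    (hφ.mem_solutions_pi (x := 0) fun i => i.elim)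
  add_mem' := fun {a b} ha hb => by
    have h : (fun c : Bool => if c then a else b) ∈ solutions (Bool → M) φ :=
      hφ.mem_solutions_pi fun c => by cases c <;> simpa
    simpa using hφ.map_mem_solutions (LinearMap.proj (R := R) (φ := fun _ : Bool => M) true +
      LinearMap.proj (R := R) (φ := fun _ : Bool => M) false) h
  neg_mem' := fun {a} ha => by
    simpa using hφ.map_mem_solutions (-LinearMap.id : M →ₗ[R] M) ha

end Formulas

end PPModule

theorem proposition4p2 {R : Type u} [Ring R] {I J : Type v} [Infinite J]
    (U : I → Type v) [∀ i, AddCommGroup (U i)] [∀ i, Module R (U i)]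
    (V : J → Type v) [∀ j, AddCommGroup (V j)] [∀ j, Module R (V j)]
    (κ : Cardinal.{v}) (hκ : ¬ PPModule.IsOmegaMeasurable κ)
    (hsup : ⨆ i, #(U i) = κ) (hJ : κ < #J)
    (f : (∀ i, U i) →ₗ[R] ⨁ j, V j) (hf : Function.Surjective f)
    (ψ : ℕ → (PPModule.moduleLanguage R).Formula (Fin 1)) (hpp : ∀ n, PPModule.IsPP (ψ n))
    (hdesc : ∀ n, PPModule.FormulaLE.{u, v} (ψ (n + 1)) (ψ n))
    (honto : {n : ℕ | Set.SurjOn f (PPModule.solutions (∀ i, U i) (ψ n))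
      (PPModule.solutions (⨁ j, V j) (ψ n))}.Infinite) :
    ∃ L : Set J, L.Infinite ∧ ∀ j ∈ L, ∃ N : ℕ, ∀ n, N ≤ n →
      PPModule.solutions (V j) (ψ n) = PPModule.solutions (V j) (ψ N) := by
  classical
  let coords : (⨁ j, V j) →+ ∀ j, V j := DFinsupp.coeFnAddMonoidHom
  have hG : Antitone fun n i => (hpp n).subgroup (U i) :=
    antitone_nat_of_succ_le fun n i => hdesc n (U i)
  have hH : Antitone fun n j => (hpp n).subgroup (V j) :=
    antitone_nat_of_succ_le fun n j => hdesc n (V j)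
  have key := PPModule.infinite_setOf_stabilizes hG hH (f := coords.comp f.toAddMonoidHom)
    (fun x => DFinsupp.finite_support (f x))
    (fun n x hx j => (hpp n).map_mem_solutions (DirectSum.component R J V j ∘ₗ f)
      ((hpp n).mem_solutions_pi hx))
    hκ (fun i => hsup ▸ le_ciSup Cardinal.bddAbove_of_small i) hJ
    (honto.mono fun n hn j h hh => by
      obtain ⟨x, hx, hfx⟩ := hn ((hpp n).map_mem_solutions (DirectSum.lof R J V j) hh)
      refine ⟨x, fun i => (hpp n).map_mem_solutions (LinearMap.proj (R := R) (φ := U) i) hx, ?_, ?_⟩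
      · change f x j = h
        rw [hfx, DirectSum.lof_eq_of, DirectSum.of_eq_same]
      · intro j' hj'
        change f x j' = 0
        rw [hfx, DirectSum.lof_eq_of, DirectSum.of_eq_of_ne _ _ _ hj'])
  exact ⟨_, key, fun j ⟨N, hN⟩ => ⟨N, fun n hn => congrArg SetLike.coe (hN n hn)⟩⟩
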